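/- Theorem. Let $n \ge 3$ and consider the ferromagnetic Ising model on the cycle with vertices $1,\dots,n$ (indices mod $n$) and couplings $\mathbf J=(J_1,\dots,J_n)$, $J_i\ge 0$, where $J_i$ is attached to the edge $[i,i+1]$. Its Gibbs measure on $\sigma\in\{+1,-1\}^n$ is $\pi(\sigma)=Z^{-1}\exp\bigl(\sum_{i=1}^n J_i\sigma_i\sigma_{i+1}\bigr)$. Let $A$ be the $2^n\times 2^n$ transition matrix of the heat-bath Glauber dynamics: $$A(\sigma,\sigma^x)=\frac1n\,\frac{\pi(\sigma^x)}{\pi(\sigma)+\pi(\sigma^x)},\qquad A(\sigma,\sigma)=1-\sum_{x}A(\sigma,\sigma^x),$$ and all other entries are $0$, where $\sigma^x$ is $\sigma$ with the spin at $x$ flipped. Let $\mu_2$ be the second largest eigenvalue of $A$ (counted with multiplicity), let $\tau_2(\mathbf J)=\bigl(n(1-\mu_2)\bigr)^{-1}$ be the relaxation time, and let $\tau^*(\mathbf J)=\tau_2(\mathbf J)-1$. Then $$\tau^*(\mathbf J+t)\ \ge\ e^{2t}\,\tau^*(\mathbf J)\qquad\text{for all } t\ge 0,$$ where $\mathbf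 J+t=(J_1+t,\dots,J_n+t)$. -/

import Mathlib

open scoped BigOperators

noncomputable section

namespace CycleIsing

/-- Spin configurations on the cycle with vertex set `Fin n` (vertices are taken mod `n`);
the spin values `+1, -1` are the units of `ℤ`. -/
abbrev Config (n : ℕ) : Type := Fin n → ℤˣ

variable {n : ℕ}

/-- The spin at the vertex `i` as a real number. -/
def spin (σ : Config n) (i : Fin n) : ℝ := ((σ i : ℤ) : ℝ)

/-- The configuration obtained by flipping the spin at `x`, leaving all others unchanged. -/
def flip (σ : Config n) (x : Fin n) : Config n := Function.update σ x (-σ x)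

/-- The unnormalised Gibbs weight `exp (∑ᵢ Jᵢ σᵢ σᵢ₊₁)`; `J i` is the coupling of the edge
`[i, i+1]`, and addition in `Fin n` is mod `n`. -/
def weight [NeZero n] (J : Fin n → ℝ) (σ : Config n) : ℝ :=
  Real.exp (∑ i, J i * spin σ i * spin σ (i + 1))

/-- The partition function `Z`. -/
def partitionFunction [NeZero n] (J : Fin n → ℝ) : ℝ := ∑ σ : Config n, weight J σ

/-- The Gibbs measure `π(σ)`. -/
def gibbs [NeZero n] (J : Fin n → ℝ) (σ : Config n) : ℝ :=
  (partitionFunction J)⁻¹ * weight J σ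

/-- The probability that one step of the heat-bath dynamics selects `x` and flips its spin. -/
def flipProb [NeZero n] (J : Fin n → ℝ) (σ : Config n) (x : Fin n) : ℝ :=
  (1 / (n : ℝ)) * (gibbs J (flip σ x) / (gibbs J σ + gibbs J (flip σ x)))

/-- The `2ⁿ × 2ⁿ` transition matrix of the heat-bath Glauber dynamics. The configurations
`flip σ x` are pairwise distinct and different from `σ`, so at most one term is nonzero. -/
def transitionMatrix [NeZero n] (J : Fin n → ℝ) : Matrix (Config n) (Config n) ℝ :=
  fun σ τ =>
    (if τ = σ then 1 - ∑ x, flipProb J σ x else 0) +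
      ∑ x, if τ = flip σ x then flipProb J σ x else 0

/-- The second entry in the list of all real eigenvalues of `A`, repeated according to
multiplicity and sorted in decreasing order (`0` if there are fewer than two). -/
def secondLargestEigenvalue {ι : Type*} [Fintype ι] [DecidableEq ι]
    (A : Matrix ι ι ℝ) : ℝ :=
  (A.charpoly.roots.sort (fun a b => b ≤ a)).getD 1 0

/-- The relaxation time `τ₂ = (n (1 - μ₂))⁻¹`. -/
def relaxationTime [NeZero n] (J : Fin n → ℝ) : ℝ :=
  ((n : ℝ) * (1 - secondLargestEigenvalue (transitionMatrix J)))⁻¹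

/-- `τ* = τ₂ - 1`. -/
def tauStar [NeZero n] (J : Fin n → ℝ) : ℝ := relaxationTime J - 1

end CycleIsing

end

/-!
Write `s = sinh 2J` and `c = cosh 2J` on the edges. The mean of the spin at `x` given its
neighbours is `(s_{x-1} σ_{x-1} + s_x σ_{x+1}) / (c_{x-1} + c_x)`, which is linear in the spins
(`flipProb_eq`), so the dynamics preserves linear functions of the spins. On these it acts through
`D⁻¹ S`, where `S` is the symmetric matrix of `crossForm s` and `D` the diagonal matrix of
`massForm c`. Let `l < 1` be the largest eigenvalue of `D⁻¹ S` (`perronRoot`), a supremum of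
quotients of the two forms.

*The second eigenvalue is `1 - (1 - l) / n`.* It is attained by a linear function with Perron
vector coefficients (`transitionMatrix_mulVec_linear`). Conversely, measuring increments of a
function under flips relative to the coefficients of a strictly positive approximate Perron vector
gives a Lipschitz seminorm that one step of the dynamics contracts by a factor as close to this
value as desired (`abs_mulVec_flip_sub_le`), so it bounds the eigenvalue of every nonconstant eigenfunction
(`eigenvalue_le_of_nonconstant`). Detailed balance makes the matrix similar to a symmetric one,
hence multiplicities in the characteristic polynomial are dimensions of eigenspaces
(`secondLargestEigenvalue_eq`). Therefore `τ* = l / (1 - l)` (`tauStar_eq`).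

*Growth.* `l / (1 - l)` is the supremum over `u` of
`∑ 2 s u_i u_{i+1} / ∑ (c (u_i² + u_{i+1}²) - 2 s u_i u_{i+1})`. Differentiating this quotient in a
uniform shift of the couplings with the Perron vector `u` held fixed, its logarithmic derivative is
at least `2` as soon as, on each edge, `l s (u_i - u_{i+1})² ≤ 2 (c - s) u_i u_{i+1}`
(`perron_derivative_inequality`). This follows from the bound `l coth J` on the ratio of
neighbouring entries of `u` in either order (`perron_ratio_le`): the eigenvalue equation is a
recursion for these ratios, and a maximum principle around the cycle excludes larger ones. As `l`
is continuous in the shift, the pointwise lower bounds on the slope integrate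
(`exp_mul_perron_le`).
-/

namespace CycleIsing

/-! ### A pair of quadratic forms on the cycle -/

/-- The quadratic form `∑ᵢ 2 sᵢ uᵢ uᵢ₊₁` on functions on the cycle. -/
noncomputable def crossForm {n : ℕ} [NeZero n] (s u : Fin n → ℝ) : ℝ :=
  ∑ i, 2 * s i * u i * u (i + 1)

/-- The quadratic form `∑ᵢ cᵢ (uᵢ² + uᵢ₊₁²)` on functions on the cycle. -/
noncomputable def massForm {n : ℕ} [NeZero n] (c u : Fin n → ℝ) : ℝ :=
  ∑ i, c i * (u i ^ 2 + u (i + 1) ^ 2)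

/-- The largest generalised eigenvalue of `crossForm s` with respect to `massForm c`: the supremum
of their quotient. The unit sphere is that of the sup norm, which does not matter because the
quotient is homogeneous of degree zero. -/
noncomputable def topEigenvalue {n : ℕ} [NeZero n] (s c : Fin n → ℝ) : ℝ :=
  sSup ((fun u : Metric.sphere (0 : Fin n → ℝ) 1 => crossForm s u / massForm c u) '' Set.univ)

section Forms

variable {n : ℕ} [NeZero n] {s c u : Fin n → ℝ}

lemma sum_add_one {M : Type*} [AddCommMonoid M] (f : Fin n → M) : ∑ i, f (i + 1) = ∑ i, f i :=
  Equiv.sum_comp (Equiv.addRight (1 : Fin n)) f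

lemma crossForm_smul (a : ℝ) : crossForm s (a • u) = a ^ 2 * crossForm s u := by
  simp only [crossForm, Finset.mul_sum, Pi.smul_apply, smul_eq_mul]
  exact Finset.sum_congr rfl fun i _ => by ring

lemma massForm_smul (a : ℝ) : massForm c (a • u) = a ^ 2 * massForm c u := by
  simp only [massForm, Finset.mul_sum, Pi.smul_apply, smul_eq_mul]
  exact Finset.sum_congr rfl fun i _ => by ring

lemma massForm_nonneg (hc : ∀ i, 0 < c i) (u : Fin n → ℝ) : 0 ≤ massForm c u :=
  Finset.sum_nonneg fun i _ => mul_nonneg (hc i).le (by positivity)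

lemma massForm_pos (hc : ∀ i, 0 < c i) (hu : u ≠ 0) : 0 < massForm c u := by
  obtain ⟨x, hx⟩ := Function.ne_iff.mp hu
  have hx' : u x ≠ 0 := hx
  refine Finset.sum_pos' (fun i _ => mul_nonneg (hc i).le (by positivity))
    ⟨x, Finset.mem_univ x, mul_pos (hc x) (by positivity)⟩

lemma exists_topEigenvalue (s : Fin n → ℝ) (hc : ∀ i, 0 < c i) :
    (∃ u : Fin n → ℝ, u ≠ 0 ∧ crossForm s u = topEigenvalue s c * massForm c u) ∧
      ∀ w : Fin n → ℝ, crossForm s w ≤ topEigenvalue s c * massForm c w := by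
  have hne : Nonempty (Metric.sphere (0 : Fin n → ℝ) 1) :=
    ⟨⟨fun _ => 1, by simp⟩⟩
  have hcont : Continuous fun u : Metric.sphere (0 : Fin n → ℝ) 1 =>
      crossForm s u / massForm c u := by
    have h1 : Continuous (crossForm s) := by unfold crossForm; fun_prop
    have h2 : Continuous (massForm c) := by unfold massForm; fun_prop
    refine (h1.comp continuous_subtype_val).div (h2.comp continuous_subtype_val) ?_
    exact fun u => (massForm_pos hc (ne_zero_of_mem_unit_sphere u)).ne'
  obtain ⟨u, -, hu, hmax⟩ := isCompact_univ.exists_sSup_image_eq_and_ge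
    (Set.univ_nonempty) hcont.continuousOn
  have hu' : topEigenvalue s c = crossForm s u / massForm c u := hu
  refine ⟨⟨u, ne_zero_of_mem_unit_sphere u, ?_⟩, fun w => ?_⟩
  · rw [hu', div_mul_cancel₀ _ (massForm_pos hc (ne_zero_of_mem_unit_sphere u)).ne']
  · rcases eq_or_ne w 0 with rfl | hw
    · simp [crossForm, massForm]
    · have hw0 : ‖w‖ ≠ 0 := norm_ne_zero_iff.mpr hw
      have h := hmax ⟨‖w‖⁻¹ • w, by simp [norm_smul, hw0]⟩ (Set.mem_univ _)
      simp only [crossForm_smul, massForm_smul] at h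
      rw [mul_div_mul_left _ _ (by positivity), ← hu', div_le_iff₀ (massForm_pos hc hw)] at h
      exact h

lemma topEigenvalue_le {b : ℝ} (hc : ∀ i, 0 < c i)
    (h : ∀ w, crossForm s w ≤ b * massForm c w) : topEigenvalue s c ≤ b := by
  obtain ⟨⟨u, hu, he⟩, -⟩ := exists_topEigenvalue s hc
  exact le_of_mul_le_mul_right (he ▸ h u) (massForm_pos hc hu)

lemma topEigenvalue_lt_one (hsc : ∀ i, |s i| < c i) : topEigenvalue s c < 1 := by
  have hc : ∀ i, 0 < c i := fun i => (abs_nonneg _).trans_lt (hsc i)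
  obtain ⟨⟨u, hu, he⟩, -⟩ := exists_topEigenvalue s hc
  have hM := massForm_pos hc hu
  refine lt_of_mul_lt_mul_right ?_ hM.le
  rw [← he, one_mul]
  obtain ⟨x, hx⟩ := Function.ne_iff.mp hu
  have hx' : u x ≠ 0 := hx
  have key : ∀ i, 2 * s i * u i * u (i + 1) ≤ |s i| * (u i ^ 2 + u (i + 1) ^ 2) := fun i => by
    have h1 : 2 * |u i * u (i + 1)| ≤ u i ^ 2 + u (i + 1) ^ 2 := by
      rw [abs_mul, ← sq_abs (u i), ← sq_abs (u (i + 1))]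
      nlinarith [sq_nonneg (|u i| - |u (i + 1)|)]
    have h2 : s i * (u i * u (i + 1)) ≤ |s i| * |u i * u (i + 1)| := by
      rw [← abs_mul]; exact le_abs_self _
    nlinarith [mul_le_mul_of_nonneg_left h1 (abs_nonneg (s i))]
  refine Finset.sum_lt_sum (fun i _ => (key i).trans ?_) ⟨x, Finset.mem_univ x, (key x).trans_lt ?_⟩
  · exact mul_le_mul_of_nonneg_right (hsc i).le (by positivity)
  · exact mul_lt_mul_of_pos_right (hsc x) (by positivity)

lemma topEigenvalue_nonneg (hs : ∀ i, 0 ≤ s i) (hc : ∀ i, 0 < c i) : 0 ≤ topEigenvalue s c := by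
  have h := (exists_topEigenvalue s hc).2 (fun _ => 1)
  have h1 : 0 ≤ crossForm s (fun _ => 1) := Finset.sum_nonneg fun i _ => by
    have := hs i
    positivity
  have h2 : 0 < massForm c (fun _ : Fin n => (1 : ℝ)) :=
    massForm_pos hc (Function.ne_iff.mpr ⟨0, by simp⟩)
  exact nonneg_of_mul_nonneg_left (h1.trans h) h2

lemma topEigenvalue_add_le {ε : ℝ} (hε : 0 ≤ ε) (hc : ∀ i, 1 ≤ c i) :
    topEigenvalue (fun i => s i + ε) c ≤ topEigenvalue s c + ε := by
  have hc' : ∀ i, 0 < c i := fun i => one_pos.trans_le (hc i)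
  refine topEigenvalue_le hc' fun w => ?_
  have h := (exists_topEigenvalue s hc').2 w
  rw [add_mul]
  have : crossForm (fun i => s i + ε) w ≤ crossForm s w + ε * massForm c w := by
    simp only [crossForm, massForm, Finset.mul_sum, ← Finset.sum_add_distrib]
    refine Finset.sum_le_sum fun i _ => ?_
    nlinarith [mul_nonneg hε (sq_nonneg (w i - w (i + 1))), mul_nonneg (mul_nonneg hε
      (sub_nonneg.mpr (hc i))) (add_nonneg (sq_nonneg (w i)) (sq_nonneg (w (i + 1))))]
  linarith

/-- A vector attaining the top eigenvalue solves the eigenvalue equation: the nonnegative form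
`topEigenvalue s c * massForm c - crossForm s` vanishes at it, so its differential does too. -/
lemma eigen_equation (hc : ∀ i, 0 < c i)
    (he : crossForm s u = topEigenvalue s c * massForm c u) (x : Fin n) :
    s (x - 1) * u (x - 1) + s x * u (x + 1) = topEigenvalue s c * ((c (x - 1) + c x) * u x) := by
  have hle := (exists_topEigenvalue s hc).2
  set l := topEigenvalue s c
  set h : Fin n → ℝ := Pi.single x 1 with hh
  set β := ∑ i, (l * (c i * (u i * h i + u (i + 1) * h (i + 1)))
    - s i * (u i * h (i + 1) + u (i + 1) * h i)) with hβ
  have hq : ∀ e : ℝ, 0 ≤ (l * massForm c h - crossForm s h) * (e * e) + (2 * β) * e + 0 := by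
    intro e
    have h0 := hle (u + e • h)
    have : l * massForm c (u + e • h) - crossForm s (u + e • h) =
        (l * massForm c u - crossForm s u) +
          ((l * massForm c h - crossForm s h) * (e * e) + (2 * β) * e) := by
      simp only [hβ, massForm, crossForm, Finset.mul_sum, Finset.sum_mul,
        ← Finset.sum_add_distrib, ← Finset.sum_sub_distrib, Pi.add_apply, Pi.smul_apply,
        smul_eq_mul]
      exact Finset.sum_congr rfl fun i _ => by ring
    linarith
  have hd := discrim_le_zero hq
  have hβ0 : β = 0 := by
    rw [discrim] at hd
    nlinarith [sq_nonneg β]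
  have e1 : β = ∑ i, h i * (l * ((c (i - 1) + c i) * u i)
      - (s (i - 1) * u (i - 1) + s i * u (i + 1))) := by
    have : β = ∑ i, h i * (l * (c i * u i) - s i * u (i + 1)) +
        ∑ i, h (i + 1) * (l * (c i * u (i + 1)) - s i * u i) := by
      rw [hβ, ← Finset.sum_add_distrib]
      exact Finset.sum_congr rfl fun i _ => by ring
    rw [this]
    have h2 := sum_add_one (n := n) fun i => h i * (l * (c (i - 1) * u i) - s (i - 1) * u (i - 1))
    simp only [add_sub_cancel_right] at h2
    rw [h2, ← Finset.sum_add_distrib]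
    exact Finset.sum_congr rfl fun i _ => by ring
  rw [hβ0, hh] at e1
  simp only [Pi.single_apply, ite_mul, one_mul, zero_mul, Finset.sum_ite_eq', Finset.mem_univ,
    if_true] at e1
  linarith

/-- Perron vector with nonnegative weights: replacing a maximiser by its absolute value does not
decrease `crossForm s`. -/
lemma exists_nonneg_eigenvector (hs : ∀ i, 0 ≤ s i) (hc : ∀ i, 0 < c i) :
    ∃ u : Fin n → ℝ, u ≠ 0 ∧ (∀ i, 0 ≤ u i) ∧
      crossForm s u = topEigenvalue s c * massForm c u := by
  obtain ⟨⟨u, hu, he⟩, hle⟩ := exists_topEigenvalue s hc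
  have hm : massForm c (fun i => |u i|) = massForm c u := by simp [massForm]
  refine ⟨fun i => |u i|, ?_, fun i => abs_nonneg _, le_antisymm (hle _) ?_⟩
  · obtain ⟨x, hx⟩ := Function.ne_iff.mp hu
    exact Function.ne_iff.mpr ⟨x, by simpa using hx⟩
  · rw [hm, ← he]
    refine Finset.sum_le_sum fun i _ => ?_
    have h1 : u i * u (i + 1) ≤ |u i| * |u (i + 1)| := by
      rw [← abs_mul]; exact le_abs_self _
    nlinarith [mul_le_mul_of_nonneg_left h1 (hs i)]

open Fin.CommRing in
lemma exists_pos_eigenvector (hs : ∀ i, 0 < s i) (hc : ∀ i, 0 < c i) :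
    ∃ u : Fin n → ℝ, (∀ i, 0 < u i) ∧ crossForm s u = topEigenvalue s c * massForm c u := by
  obtain ⟨u, hu, hu0, he⟩ := exists_nonneg_eigenvector (fun i => (hs i).le) hc
  refine ⟨u, ?_, he⟩
  -- a zero of `u` spreads to its right neighbour, hence around the cycle
  have step : ∀ x, u x = 0 → u (x + 1) = 0 := fun x hx => by
    have h := eigen_equation hc he x
    rw [hx, mul_zero, mul_zero] at h
    have h1 := mul_nonneg (hs (x - 1)).le (hu0 (x - 1))
    have h2 := mul_nonneg (hs x).le (hu0 (x + 1))
    have h3 : s x * u (x + 1) = 0 := by linarith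
    exact (mul_eq_zero.mp h3).resolve_left (hs x).ne'
  by_contra! hcon
  obtain ⟨x, hx⟩ := hcon
  have hx0 : u x = 0 := le_antisymm hx (hu0 x)
  have all : ∀ k : ℕ, u (x + (k : Fin n)) = 0 := fun k => by
    induction k with
    | zero => simpa using hx0
    | succ k ih =>
      have := step _ ih
      rwa [add_assoc, ← Nat.cast_succ] at this
  refine hu (funext fun y => ?_)
  have := all (y - x).val
  rwa [Fin.cast_val_eq_self, add_sub_cancel] at this

end Forms

/-! ### The spectral radius as a function of the couplings -/

/-- The weights `sinh 2Jᵢ` of the form `crossForm`. -/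
noncomputable def sinhWeight {n : ℕ} (J : Fin n → ℝ) (i : Fin n) : ℝ := Real.sinh (2 * J i)

/-- The weights `cosh 2Jᵢ` of the form `massForm`. -/
noncomputable def coshWeight {n : ℕ} (J : Fin n → ℝ) (i : Fin n) : ℝ := Real.cosh (2 * J i)

/-- The spectral radius of the nonnegative matrix by which the single-site updates act on linear
functions of the spins. -/
noncomputable def perronRoot {n : ℕ} [NeZero n] (J : Fin n → ℝ) : ℝ :=
  topEigenvalue (sinhWeight J) (coshWeight J)

section Perron

variable {n : ℕ} [NeZero n] {J : Fin n → ℝ}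

omit [NeZero n] in
lemma coshWeight_pos (J : Fin n → ℝ) (i : Fin n) : 0 < coshWeight J i := Real.cosh_pos _

omit [NeZero n] in
lemma one_le_coshWeight (J : Fin n → ℝ) (i : Fin n) : 1 ≤ coshWeight J i := Real.one_le_cosh _

omit [NeZero n] in
lemma coshWeight_sq (J : Fin n → ℝ) (i : Fin n) : coshWeight J i ^ 2 = sinhWeight J i ^ 2 + 1 :=
  Real.cosh_sq _

omit [NeZero n] in
lemma abs_sinhWeight_lt (J : Fin n → ℝ) (i : Fin n) : |sinhWeight J i| < coshWeight J i :=
  abs_lt_of_sq_lt_sq (by linarith [coshWeight_sq J i]) (coshWeight_pos J i).le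

omit [NeZero n] in
lemma sinhWeight_nonneg (hJ : ∀ i, 0 ≤ J i) (i : Fin n) : 0 ≤ sinhWeight J i :=
  Real.sinh_nonneg_iff.mpr (by linarith [hJ i])

omit [NeZero n] in
lemma sinhWeight_pos (hJ : ∀ i, 0 < J i) (i : Fin n) : 0 < sinhWeight J i :=
  Real.sinh_pos_iff.mpr (by linarith [hJ i])

lemma perronRoot_lt_one (J : Fin n → ℝ) : perronRoot J < 1 :=
  topEigenvalue_lt_one (abs_sinhWeight_lt J)

lemma perronRoot_nonneg (hJ : ∀ i, 0 ≤ J i) : 0 ≤ perronRoot J :=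
  topEigenvalue_nonneg (sinhWeight_nonneg hJ) (coshWeight_pos J)

lemma continuous_perronRoot (J : Fin n → ℝ) : Continuous fun t => perronRoot fun i => J i + t := by
  set f : ℝ → Metric.sphere (0 : Fin n → ℝ) 1 → ℝ := fun t u =>
    crossForm (sinhWeight fun i => J i + t) u / massForm (coshWeight fun i => J i + t) u with hf
  have key : Continuous (Function.uncurry f) := by
    have h1 : Continuous fun p : ℝ × (Fin n → ℝ) =>
        crossForm (sinhWeight fun i => J i + p.1) p.2 := by
      unfold crossForm sinhWeight; fun_prop
    have h2 : Continuous fun p : ℝ × (Fin n → ℝ) =>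
        massForm (coshWeight fun i => J i + p.1) p.2 := by
      unfold massForm coshWeight; fun_prop
    have h3 : Continuous fun p : ℝ × Metric.sphere (0 : Fin n → ℝ) 1 =>
        (p.1, (p.2 : Fin n → ℝ)) := by
      fun_prop
    have h1' := h1.comp h3
    have h2' := h2.comp h3
    refine h1'.div h2' fun p => ?_
    exact (massForm_pos (coshWeight_pos _) (ne_zero_of_mem_unit_sphere p.2)).ne'
  exact isCompact_univ.continuous_sSup key

/-! ### Ratios of neighbouring entries of the Perron vector -/

/-- With `y / z` the ratio of two neighbouring entries of the Perron vector, the eigenvalue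
equation turns the excess `s y / z - l c` of one edge into minus the reversed excess of the
next. No excess above `l` can reproduce itself under this recursion. -/
lemma le_of_excess_recursion {l s c A : ℝ} {y z : ℝ} (hl : 0 ≤ l) (hl1 : l < 1) (hc : 1 ≤ c)
    (hs : 0 < s) (hcs : c ^ 2 = s ^ 2 + 1) (hy : 0 < y) (hz : 0 < z)
    (h1 : s * (y / z) - l * c ≤ A) (h2 : A = l * c - s * (z / y)) : A ≤ l := by
  by_contra! hA
  have hr : 0 < y / z := div_pos hy hz
  have hinv : (y / z) * (z / y) = 1 := by field_simp
  have hr' : 0 < z / y := div_pos hz hy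
  have h3 : (l * c - A) * (A + l * c) ≥ s ^ 2 := by
    have e : l * c - A = s * (z / y) := by linarith
    rw [e]
    have h4 : s * (y / z) ≤ A + l * c := by linarith
    calc s * (z / y) * (A + l * c) ≥ s * (z / y) * (s * (y / z)) :=
          mul_le_mul_of_nonneg_left h4 (by positivity)
      _ = s ^ 2 := by linear_combination s ^ 2 * hinv
  nlinarith [mul_nonneg (sub_nonneg.mpr (one_le_pow₀ hc : (1 : ℝ) ≤ c ^ 2))
    (by nlinarith : 0 ≤ 1 - l ^ 2)]

lemma perron_equation {u : Fin n → ℝ}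
    (he : crossForm (sinhWeight J) u = perronRoot J * massForm (coshWeight J) u) (x : Fin n) :
    sinhWeight J x * u x + sinhWeight J (x + 1) * u (x + 1 + 1) =
      perronRoot J * ((coshWeight J x + coshWeight J (x + 1)) * u (x + 1)) := by
  have h := eigen_equation (coshWeight_pos J) he (x + 1)
  rwa [add_sub_cancel_right] at h

lemma perron_ratio_le (hJ : ∀ i, 0 < J i) {u : Fin n → ℝ} (hu : ∀ i, 0 < u i)
    (he : crossForm (sinhWeight J) u = perronRoot J * massForm (coshWeight J) u) (x : Fin n) :
    sinhWeight J x * u (x + 1) ≤ perronRoot J * (coshWeight J x + 1) * u x ∧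
      sinhWeight J x * u x ≤ perronRoot J * (coshWeight J x + 1) * u (x + 1) := by
  have heq := perron_equation he
  have hl := perronRoot_nonneg fun i => (hJ i).le
  have hl1 := perronRoot_lt_one J
  set l := perronRoot J
  set s := sinhWeight J
  set c := coshWeight J
  have hrec : ∀ x, s (x + 1) * (u (x + 1 + 1) / u (x + 1)) - l * c (x + 1) =
      l * c x - s x * (u x / u (x + 1)) := fun x => by
    have := (hu (x + 1)).ne'
    field_simp
    linarith [heq x]
  have fwd : ∀ x, s x * (u (x + 1) / u x) - l * c x ≤ l := fun x => by
    obtain ⟨m, hm⟩ := Finite.exists_max fun x => s x * (u (x + 1) / u x) - l * c x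
    refine (hm x).trans ?_
    obtain ⟨k, rfl⟩ : ∃ k, m = k + 1 := ⟨m - 1, by simp⟩
    exact le_of_excess_recursion hl hl1 (one_le_coshWeight J k) (sinhWeight_pos hJ k)
      (coshWeight_sq J k) (hu (k + 1)) (hu k) (hm k) (hrec k)
  have bwd : ∀ x, s x * (u x / u (x + 1)) - l * c x ≤ l := fun x => by
    obtain ⟨m, hm⟩ := Finite.exists_max fun x => s x * (u x / u (x + 1)) - l * c x
    refine (hm x).trans ?_
    exact le_of_excess_recursion hl hl1 (one_le_coshWeight J (m + 1)) (sinhWeight_pos hJ (m + 1))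
      (coshWeight_sq J (m + 1)) (hu (m + 1)) (hu (m + 1 + 1)) (hm (m + 1))
      (by linarith [hrec m])
  have f := fwd x
  have b := bwd x
  rw [sub_le_iff_le_add, mul_div_assoc', div_le_iff₀ (hu _)] at f b
  exact ⟨f.trans (by linarith), b.trans (by linarith)⟩

/-- On a single edge, the ratio bound controls the squared difference. For `l = 1` the extremal
ratio `(c + 1) / s = coth J` gives equality. -/
lemma sq_sub_le_of_ratio_le {l s c u v : ℝ} (hl : 0 ≤ l) (hl1 : l ≤ 1) (hs : 0 < s) (hc : 1 ≤ c)
    (hcs : c ^ 2 = s ^ 2 + 1) (hu : 0 < u) (hv : 0 < v)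
    (h1 : s * v ≤ l * (c + 1) * u) (h2 : s * u ≤ l * (c + 1) * v) :
    l * (s * (u - v) ^ 2) ≤ 2 * (c - s) * (u * v) := by
  wlog huv : u ≤ v generalizing u v
  · have := this hv hu h2 h1 (by linarith)
    nlinarith
  -- the ratio bound gives `v - u` relative to `u` and relative to `v`; the two are multiplied
  have hsc : s < c := by nlinarith
  have a1 : s * (v - u) ≤ (l * (c + 1) - s) * u := by linarith
  have a2 : l * (c + 1) * (v - u) ≤ (l * (c + 1) - s) * v := by linarith
  have a0 : 0 ≤ l * (c + 1) - s := by
    by_contra! h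
    nlinarith [mul_nonneg hs.le (sub_nonneg.mpr huv), mul_pos (neg_pos.mpr h) hu]
  have a3 : l * (c + 1) - s ≤ c + 1 - s := by nlinarith
  have a4 : (s * (v - u)) * (l * (c + 1) * (v - u)) ≤
      ((l * (c + 1) - s) * u) * ((l * (c + 1) - s) * v) :=
    mul_le_mul a1 a2 (mul_nonneg (mul_nonneg hl (by linarith)) (by linarith)) (by positivity)
  have a5 : (l * (c + 1) - s) ^ 2 ≤ (c + 1 - s) ^ 2 := pow_le_pow_left₀ a0 a3 2
  have a6 : (c + 1 - s) ^ 2 = (c + 1) * (2 * (c - s)) := by linear_combination -hcs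
  have huv0 : 0 < u * v := mul_pos hu hv
  refine le_of_mul_le_mul_left ?_ (by linarith : 0 < c + 1)
  nlinarith [mul_le_mul_of_nonneg_right a5 huv0.le]

/-! ### Growth of the relaxation time -/

lemma hasDerivAt_crossForm (J u : Fin n → ℝ) (x : ℝ) :
    HasDerivAt (fun t => crossForm (sinhWeight fun i => J i + t) u)
      (2 * crossForm (coshWeight fun i => J i + x) u) x := by
  unfold crossForm sinhWeight coshWeight
  rw [Finset.mul_sum]
  refine HasDerivAt.fun_sum fun i _ => ?_
  have h : HasDerivAt (fun t => 2 * (J i + t)) 2 x := by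
    simpa using ((hasDerivAt_id x).const_add (J i)).const_mul 2
  refine (((h.sinh.const_mul 2).mul_const (u i)).mul_const (u (i + 1))).congr_deriv ?_
  ring

lemma hasDerivAt_massForm (J u : Fin n → ℝ) (x : ℝ) :
    HasDerivAt (fun t => massForm (coshWeight fun i => J i + t) u)
      (2 * massForm (sinhWeight fun i => J i + x) u) x := by
  unfold massForm sinhWeight coshWeight
  rw [Finset.mul_sum]
  refine HasDerivAt.fun_sum fun i _ => ?_
  have h : HasDerivAt (fun t => 2 * (J i + t)) 2 x := by
    simpa using ((hasDerivAt_id x).const_add (J i)).const_mul 2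
  refine (h.cosh.mul_const _).congr_deriv ?_
  ring

/-- The inequality between the forms at the Perron vector which says that the logarithmic
derivative of the quotient `crossForm / (massForm - crossForm)` in a uniform shift of the
couplings is at least `2`. -/
lemma perron_derivative_inequality (hJ : ∀ i, 0 < J i) {u : Fin n → ℝ} (hu : ∀ i, 0 < u i)
    (he : crossForm (sinhWeight J) u = perronRoot J * massForm (coshWeight J) u) :
    perronRoot J * massForm (sinhWeight J) u + (1 - perronRoot J) * crossForm (sinhWeight J) u
      ≤ crossForm (coshWeight J) u := by
  simp only [crossForm, massForm, Finset.mul_sum, ← Finset.sum_add_distrib]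
  refine Finset.sum_le_sum fun i _ => ?_
  obtain ⟨h1, h2⟩ := perron_ratio_le hJ hu he i
  have h := sq_sub_le_of_ratio_le (perronRoot_nonneg fun i => (hJ i).le) (perronRoot_lt_one J).le
    (sinhWeight_pos hJ i) (one_le_coshWeight J i) (coshWeight_sq J i) (hu i) (hu (i + 1)) h1 h2
  linarith

/-- `l / (1 - l)` as a supremum of the quotients of `crossForm` by `massForm - crossForm`. -/
lemma quotient_le_perron {w : Fin n → ℝ} (hw : w ≠ 0) :
    crossForm (sinhWeight J) w / (massForm (coshWeight J) w - crossForm (sinhWeight J) w) ≤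
      perronRoot J / (1 - perronRoot J) := by
  have hle : crossForm (sinhWeight J) w ≤ perronRoot J * massForm (coshWeight J) w :=
    (exists_topEigenvalue _ (coshWeight_pos J)).2 w
  have hM := massForm_pos (coshWeight_pos J) hw
  have hl := perronRoot_lt_one J
  rw [div_le_div_iff₀ (by nlinarith) (by linarith)]
  linarith

lemma exp_mul_perron_le (hJ : ∀ i, 0 ≤ J i) {t : ℝ} (ht : 0 ≤ t) :
    Real.exp (2 * t) * (perronRoot J / (1 - perronRoot J)) ≤
      perronRoot (fun i => J i + t) / (1 - perronRoot fun i => J i + t) := by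
  set F : ℝ → ℝ := fun t => Real.exp (-(2 * t)) *
    (perronRoot (fun i => J i + t) / (1 - perronRoot fun i => J i + t)) with hF
  have hcont : Continuous F := by
    have := continuous_perronRoot J
    refine (by fun_prop : Continuous fun t : ℝ => Real.exp (-(2 * t))).mul (this.div
      (continuous_const.sub this) fun t => ?_)
    exact (sub_pos.mpr (perronRoot_lt_one _)).ne'
  -- lower bound for the slope of `F` at `x`, from the Perron vector at `x` as a trial vector
  have slope_bound : ∀ x, 0 < x → ∀ r, 0 < r →
      ∃ᶠ z in nhdsWithin x (Set.Ioi x), slope (-F) x z < r := by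
    intro x hx r hr
    have hJx : ∀ i, 0 < J i + x := fun i => by linarith [hJ i]
    obtain ⟨u, hu, he⟩ := exists_pos_eigenvector (sinhWeight_pos hJx)
      (coshWeight_pos fun i => J i + x)
    change crossForm _ u = perronRoot (fun i => J i + x) * massForm _ u at he
    have hu0 : u ≠ 0 := Function.ne_iff.mpr ⟨0, (hu 0).ne'⟩
    set P : ℝ → ℝ := fun t => crossForm (sinhWeight fun i => J i + t) u with hP
    set Q : ℝ → ℝ := fun t => massForm (coshWeight fun i => J i + t) u with hQ
    set g : ℝ → ℝ := fun t => Real.exp (-(2 * t)) * (P t / (Q t - P t)) with hg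
    have hgF : ∀ t, g t ≤ F t := fun t =>
      mul_le_mul_of_nonneg_left (quotient_le_perron hu0) (Real.exp_pos _).le
    have hl := perronRoot_lt_one fun i => J i + x
    have hQx : 0 < Q x := massForm_pos (coshWeight_pos _) hu0
    have hPx : P x = perronRoot (fun i => J i + x) * Q x := he
    have hineq := perron_derivative_inequality hJx hu he
    set l := perronRoot fun i => J i + x
    have hN : Q x - P x = (1 - l) * Q x := by rw [hPx]; ring
    have hNpos : 0 < Q x - P x := by rw [hN]; exact mul_pos (by linarith) hQx
    have hgx : g x = F x := by
      simp only [hg, hF]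
      rw [hN, hPx, mul_div_mul_right _ _ hQx.ne']
    set P' := crossForm (coshWeight fun i => J i + x) u
    set Q' := massForm (sinhWeight fun i => J i + x) u
    have hder : HasDerivAt g (Real.exp (-(2 * x)) * (-2) * (P x / (Q x - P x)) +
        Real.exp (-(2 * x)) * ((2 * P' * (Q x - P x) - P x * (2 * Q' - 2 * P')) /
          (Q x - P x) ^ 2)) x := by
      have e1 : HasDerivAt (fun t : ℝ => Real.exp (-(2 * t))) (Real.exp (-(2 * x)) * (-2)) x := by
        have : HasDerivAt (fun t : ℝ => -(2 * t)) (-2) x := by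
          simpa using ((hasDerivAt_id x).const_mul 2).fun_neg
        exact this.exp
      have e2 := hasDerivAt_crossForm J u x
      exact e1.mul (e2.div ((hasDerivAt_massForm J u x).sub e2) hNpos.ne')
    have hnn : 0 ≤ Real.exp (-(2 * x)) * (-2) * (P x / (Q x - P x)) +
        Real.exp (-(2 * x)) * ((2 * P' * (Q x - P x) - P x * (2 * Q' - 2 * P')) /
          (Q x - P x) ^ 2) := by
      have e3 : Real.exp (-(2 * x)) * (-2) * (P x / (Q x - P x)) +
        Real.exp (-(2 * x)) * ((2 * P' * (Q x - P x) - P x * (2 * Q' - 2 * P')) /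
          (Q x - P x) ^ 2) = Real.exp (-(2 * x)) *
            (2 * (P' * Q x - P x * Q' - P x * (Q x - P x)) / (Q x - P x) ^ 2) := by
        field_simp
        ring
      rw [e3]
      have e4 : P' * Q x - P x * Q' - P x * (Q x - P x) =
          Q x * (P' - (l * Q' + (1 - l) * P x)) := by
        rw [hN, hPx]; ring
      rw [e4]
      have : 0 ≤ P' - (l * Q' + (1 - l) * P x) := sub_nonneg.mpr hineq
      positivity
    have hlim := (hasDerivWithinAt_iff_tendsto_slope' (by simp)).mp
      (hder.hasDerivWithinAt (s := Set.Ioi x))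
    have hev := hlim.eventually (lt_mem_nhds (lt_of_lt_of_le (neg_lt_zero.mpr hr) hnn))
    refine Filter.Eventually.frequently ?_
    filter_upwards [hev, self_mem_nhdsWithin] with z hz hxz
    have hzx : 0 < z - x := sub_pos.mpr hxz
    rw [slope_def_field, lt_div_iff₀ hzx] at hz
    rw [slope_def_field, div_lt_iff₀ hzx, Pi.neg_apply, Pi.neg_apply]
    have := hgF z
    rw [hgx] at hz
    linarith
  have mono : ∀ a, 0 < a → a ≤ t → F a ≤ F t := fun a ha hat => by
    have := image_le_of_liminf_slope_right_le_deriv_boundary (f := -F) (a := a) (b := t)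
      (B := fun _ => -F a) (B' := fun _ => 0) hcont.neg.continuousOn le_rfl continuousOn_const
      (fun x _ => hasDerivWithinAt_const _ _ _)
      (fun x hx r hr => slope_bound x (ha.trans_le hx.1) r hr) (Set.right_mem_Icc.mpr hat)
    simpa using this
  have main : F 0 ≤ F t := by
    rcases ht.eq_or_lt with rfl | ht0
    · exact le_rfl
    · refine le_of_tendsto (hcont.continuousWithinAt (s := Set.Ioi 0) (x := 0)) ?_
      filter_upwards [Ioo_mem_nhdsGT ht0] with a ha using mono a ha.1 ha.2.le
  simp only [hF, mul_zero, neg_zero, Real.exp_zero, one_mul, add_zero] at main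
  calc _ ≤ Real.exp (2 * t) * (Real.exp (-(2 * t)) * _) :=
        mul_le_mul_of_nonneg_left main (Real.exp_pos _).le
    _ = _ := by rw [← mul_assoc, ← Real.exp_add, add_neg_cancel, Real.exp_zero, one_mul]

end Perron

/-! ### The flip probabilities of the heat-bath dynamics -/

/-- The conditional expectation of the spin at `x` given the other spins, written as the linear
function of the neighbouring spins that it is. -/
noncomputable def meanSpin {n : ℕ} [NeZero n] (J : Fin n → ℝ) (σ : Config n) (x : Fin n) : ℝ :=
  (sinhWeight J (x - 1) * spin σ (x - 1) + sinhWeight J x * spin σ (x + 1)) /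
    (coshWeight J (x - 1) + coshWeight J x)

section Dynamics

variable {n : ℕ}

lemma spin_eq_or (σ : Config n) (x : Fin n) : spin σ x = 1 ∨ spin σ x = -1 := by
  rcases Int.units_eq_one_or (σ x) with h | h <;> simp [spin, h]

lemma spin_mul_self (σ : Config n) (x : Fin n) : spin σ x * spin σ x = 1 := by
  rcases spin_eq_or σ x with h | h <;> simp [h]

lemma abs_spin (σ : Config n) (x : Fin n) : |spin σ x| = 1 := by
  rcases spin_eq_or σ x with h | h <;> simp [h]

lemma spin_flip_self (σ : Config n) (x : Fin n) : spin (flip σ x) x = -spin σ x := by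
  simp [spin, flip]

lemma spin_flip_of_ne (σ : Config n) {x y : Fin n} (h : y ≠ x) :
    spin (flip σ x) y = spin σ y := by
  simp [spin, flip, h]

lemma spin_flip (σ : Config n) (x y : Fin n) :
    spin (flip σ x) y = spin σ y + if y = x then -2 * spin σ x else 0 := by
  by_cases h : y = x
  · subst h
    rw [spin_flip_self, if_pos rfl]
    ring
  · rw [spin_flip_of_ne σ h, if_neg h, add_zero]

@[simp] lemma flip_flip (σ : Config n) (x : Fin n) : flip (flip σ x) x = σ := by
  simp [flip]

lemma flip_comm (σ : Config n) (x y : Fin n) : flip (flip σ x) y = flip (flip σ y) x := by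
  rcases eq_or_ne x y with rfl | h
  · rfl
  · simp only [flip, Function.update_of_ne h, Function.update_of_ne h.symm]
    exact Function.update_comm h _ _ _

/-- A function invariant under all single flips is constant. -/
lemma eq_of_flip_invariant {α : Type*} {g : Config n → α} (h : ∀ σ x, g (flip σ x) = g σ)
    (σ τ : Config n) : g σ = g τ := by
  classical
  have key : ∀ S : Finset (Fin n), g (fun i => if i ∈ S then τ i else σ i) = g σ := by
    intro S
    induction S using Finset.induction_on with
    | empty => simp
    | insert a S ha ih =>
      rw [← ih]
      rcases eq_or_ne (τ a) (σ a) with e | e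
      · congr 1
        funext i
        by_cases hi : i = a
        · subst hi; simp [ha, e]
        · simp [hi]
      · rw [← h (fun i => if i ∈ S then τ i else σ i) a]
        congr 1
        funext i
        by_cases hi : i = a
        · subst hi; simpa [flip, ha] using Int.units_ne_iff_eq_neg.mp e
        · simp [flip, hi]
  simpa using (key Finset.univ).symm

variable [NeZero n] {J : Fin n → ℝ}

lemma weight_pos (J : Fin n → ℝ) (σ : Config n) : 0 < weight J σ := Real.exp_pos _

lemma partitionFunction_pos (J : Fin n → ℝ) : 0 < partitionFunction J :=
  Finset.sum_pos (fun σ _ => weight_pos J σ) Finset.univ_nonempty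

lemma flipProb_eq_weight (J : Fin n → ℝ) (σ : Config n) (x : Fin n) :
    flipProb J σ x = 1 / (n : ℝ) * (weight J (flip σ x) / (weight J σ + weight J (flip σ x))) := by
  rw [flipProb, gibbs, gibbs, ← mul_add,
    mul_div_mul_left _ _ (inv_ne_zero (partitionFunction_pos J).ne')]

lemma add_one_ne_self (hn : 2 ≤ n) (x : Fin n) : x + 1 ≠ x := by
  intro h
  have h1 : (1 : Fin n) = 0 := by simpa using h
  have := congrArg Fin.val h1
  rw [Fin.val_one', Fin.val_zero, Nat.mod_eq_of_lt (by omega)] at this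
  omega

lemma weight_flip (hn : 2 ≤ n) (J : Fin n → ℝ) (σ : Config n) (x : Fin n) :
    weight J (flip σ x) = weight J σ * Real.exp (-(2 * spin σ x *
      (J (x - 1) * spin σ (x - 1) + J x * spin σ (x + 1)))) := by
  rw [weight, weight, ← Real.exp_add]
  congr 1
  have h0 : ∀ i, J i * spin (flip σ x) i * spin (flip σ x) (i + 1) =
      J i * spin σ i * spin σ (i + 1) +
        (if i = x then -2 * spin σ x * (J i * spin σ (i + 1)) else 0) +
        (if i + 1 = x then -2 * spin σ x * (J (i + 1 - 1) * spin σ (i + 1 - 1)) else 0) := by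
    intro i
    rw [spin_flip, spin_flip, add_sub_cancel_right]
    by_cases h1 : i = x
    · have h2 : i + 1 ≠ x := h1 ▸ add_one_ne_self hn i
      simp only [h1, h1 ▸ h2, if_true, if_false]
      ring
    · by_cases h2 : i + 1 = x
      · simp only [h1, h2, if_true, if_false]
        ring
      · simp only [h1, h2, if_false]
        ring
  rw [Finset.sum_congr rfl fun i _ => h0 i, Finset.sum_add_distrib, Finset.sum_add_distrib,
    sum_add_one fun i => if i = x then -2 * spin σ x * (J (i - 1) * spin σ (i - 1)) else 0]
  simp only [Finset.sum_ite_eq', Finset.mem_univ, if_true]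
  ring

lemma coshWeight_add_pos (J : Fin n → ℝ) (x : Fin n) : 0 < coshWeight J (x - 1) + coshWeight J x :=
  add_pos (coshWeight_pos J _) (coshWeight_pos J _)

omit [NeZero n] in
lemma sinhWeight_mul_spin (J : Fin n → ℝ) (σ : Config n) (x y : Fin n) :
    sinhWeight J x * spin σ y = Real.sinh (2 * (J x * spin σ y)) := by
  rcases spin_eq_or σ y with h | h <;> simp [sinhWeight, h]

omit [NeZero n] in
lemma coshWeight_eq_spin (J : Fin n → ℝ) (σ : Config n) (x y : Fin n) :
    coshWeight J x = Real.cosh (2 * (J x * spin σ y)) := by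
  rcases spin_eq_or σ y with h | h <;> simp [coshWeight, h]

lemma meanSpin_eq_tanh (J : Fin n → ℝ) (σ : Config n) (x : Fin n) :
    meanSpin J σ x = Real.tanh (J (x - 1) * spin σ (x - 1) + J x * spin σ (x + 1)) := by
  rw [meanSpin, sinhWeight_mul_spin, sinhWeight_mul_spin, coshWeight_eq_spin J σ (x - 1) (x - 1),
    coshWeight_eq_spin J σ x (x + 1)]
  set a := J (x - 1) * spin σ (x - 1)
  set b := J x * spin σ (x + 1)
  have ha := Real.cosh_pos a
  have hb := Real.cosh_pos b
  rw [Real.tanh_eq_sinh_div_cosh, div_eq_div_iff (by positivity) (Real.cosh_pos _).ne',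
    Real.sinh_two_mul, Real.sinh_two_mul, Real.cosh_two_mul, Real.cosh_two_mul, Real.sinh_add,
    Real.cosh_add]
  have h1 := Real.cosh_sq a
  have h2 := Real.cosh_sq b
  linear_combination (Real.sinh a * Real.cosh b - Real.cosh a * Real.sinh b) * (h1 - h2)

/-- The flip rate is an affine function of `spin σ x` times the neighbouring spins. -/
lemma flipProb_eq (hn : 2 ≤ n) (J : Fin n → ℝ) (σ : Config n) (x : Fin n) :
    flipProb J σ x = 1 / (n : ℝ) * ((1 - spin σ x * meanSpin J σ x) / 2) := by
  rw [flipProb_eq_weight, weight_flip hn, meanSpin_eq_tanh]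
  congr 1
  set h := J (x - 1) * spin σ (x - 1) + J x * spin σ (x + 1)
  have hw := (weight_pos J σ).ne'
  have e1 : spin σ x * Real.tanh h = Real.tanh (spin σ x * h) := by
    rcases spin_eq_or σ x with e | e <;> simp [e]
  rw [e1, show 2 * spin σ x * h = spin σ x * h + spin σ x * h by ring]
  set y := spin σ x * h
  rw [Real.tanh_eq_sinh_div_cosh, Real.sinh_eq, Real.cosh_eq, neg_add, Real.exp_add, Real.exp_neg]
  have hy := Real.exp_pos y
  field_simp
  ring

lemma meanSpin_flip_self (hn : 2 ≤ n) (J : Fin n → ℝ) (σ : Config n) (x : Fin n) :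
    meanSpin J (flip σ x) x = meanSpin J σ x := by
  have h1 : x - 1 ≠ x := fun h => add_one_ne_self hn x (by rw [sub_eq_iff_eq_add] at h; exact h.symm)
  rw [meanSpin, meanSpin, spin_flip_of_ne σ h1, spin_flip_of_ne σ (add_one_ne_self hn x)]

lemma abs_meanSpin_flip_sub_le (hJ : ∀ i, 0 ≤ J i) (σ : Config n) (x y : Fin n) :
    |meanSpin J (flip σ x) y - meanSpin J σ y| ≤
      2 * (((if y - 1 = x then sinhWeight J (y - 1) else 0) +
        if y + 1 = x then sinhWeight J y else 0) / (coshWeight J (y - 1) + coshWeight J y)) := by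
  have hd := coshWeight_add_pos J y
  have s1 := sinhWeight_nonneg hJ (y - 1)
  have s2 := sinhWeight_nonneg hJ y
  rw [meanSpin, meanSpin, ← sub_div, abs_div, abs_of_pos hd, mul_div_assoc',
    div_le_div_iff_of_pos_right hd, spin_flip, spin_flip]
  have h2 : ∀ (a : ℝ) (p : Prop) [Decidable p], 0 ≤ a →
      |a * (if p then -2 * spin σ x else 0)| ≤ 2 * if p then a else 0 := by
    intro a p _ ha
    split_ifs
    · rw [abs_mul, abs_mul, abs_spin, abs_of_nonneg ha]
      norm_num
      linarith
    · simp
  calc _ = |sinhWeight J (y - 1) * (if y - 1 = x then -2 * spin σ x else 0) +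
        sinhWeight J y * (if y + 1 = x then -2 * spin σ x else 0)| := by
        congr 1; ring
    _ ≤ _ := (abs_add_le _ _).trans (by linarith [h2 _ (y - 1 = x) s1, h2 _ (y + 1 = x) s2])

lemma abs_meanSpin_le_one (J : Fin n → ℝ) (σ : Config n) (x : Fin n) : |meanSpin J σ x| ≤ 1 := by
  rw [meanSpin_eq_tanh, abs_le]
  exact ⟨(Real.neg_one_lt_tanh _).le, (Real.tanh_lt_one _).le⟩

lemma transitionMatrix_mulVec (J : Fin n → ℝ) (g : Config n → ℝ) (σ : Config n) :
    (transitionMatrix J).mulVec g σ = g σ + ∑ x, flipProb J σ x * (g (flip σ x) - g σ) := by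
  simp only [Matrix.mulVec, dotProduct, transitionMatrix, add_mul, Finset.sum_add_distrib,
    Finset.sum_mul, ite_mul, zero_mul]
  rw [Finset.sum_comm]
  simp only [Finset.sum_ite_eq', Finset.mem_univ, if_true, mul_sub, Finset.sum_sub_distrib,
    sub_mul, one_mul, ← Finset.sum_mul]
  ring

/-- The Perron vector gives a linear eigenfunction of the dynamics. -/
lemma transitionMatrix_mulVec_linear (hn : 2 ≤ n) {u : Fin n → ℝ}
    (he : crossForm (sinhWeight J) u = perronRoot J * massForm (coshWeight J) u) :
    (transitionMatrix J).mulVec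
        (fun σ => ∑ x, (coshWeight J (x - 1) + coshWeight J x) * u x * spin σ x) =
      (1 - (1 - perronRoot J) / n) •
        fun σ => ∑ x, (coshWeight J (x - 1) + coshWeight J x) * u x * spin σ x := by
  funext σ
  rw [transitionMatrix_mulVec, Pi.smul_apply, smul_eq_mul]
  have hnz : (n : ℝ) ≠ 0 := Nat.cast_ne_zero.mpr (NeZero.ne n)
  have h1 : ∀ x, flipProb J σ x *
      (∑ y, (coshWeight J (y - 1) + coshWeight J y) * u y * spin (flip σ x) y -
        ∑ y, (coshWeight J (y - 1) + coshWeight J y) * u y * spin σ y) =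
      1 / (n : ℝ) * (u x * (sinhWeight J (x - 1) * spin σ (x - 1)) +
        u x * (sinhWeight J x * spin σ (x + 1)) -
        (coshWeight J (x - 1) + coshWeight J x) * u x * spin σ x) := by
    intro x
    rw [← Finset.sum_sub_distrib]
    have : ∀ y, (coshWeight J (y - 1) + coshWeight J y) * u y * spin (flip σ x) y -
        (coshWeight J (y - 1) + coshWeight J y) * u y * spin σ y =
        if y = x then (coshWeight J (y - 1) + coshWeight J y) * u y * (-2 * spin σ x) else 0 := by
      intro y
      rw [spin_flip]
      split_ifs <;> ring
    simp only [this, Finset.sum_ite_eq', Finset.mem_univ, if_true]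
    rw [flipProb_eq hn, meanSpin]
    have hd := (coshWeight_add_pos J x).ne'
    have hσ := spin_mul_self σ x
    field_simp
    linear_combination (u x * (sinhWeight J (x - 1) * spin σ (x - 1)) +
        u x * (sinhWeight J x * spin σ (x + 1))) * hσ
  rw [Finset.sum_congr rfl fun x _ => h1 x, ← Finset.mul_sum, Finset.sum_sub_distrib,
    Finset.sum_add_distrib]
  have h2 : ∑ x, u x * (sinhWeight J (x - 1) * spin σ (x - 1)) =
      ∑ x, u (x + 1) * (sinhWeight J x * spin σ x) := by
    rw [← sum_add_one]; simp
  have h3 : ∑ x, u x * (sinhWeight J x * spin σ (x + 1)) =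
      ∑ x, u (x - 1) * (sinhWeight J (x - 1) * spin σ x) := by
    rw [← sum_add_one fun x => u (x - 1) * (sinhWeight J (x - 1) * spin σ x)]; simp
  have h4 : ∑ x, u x * (sinhWeight J (x - 1) * spin σ (x - 1)) +
      ∑ x, u x * (sinhWeight J x * spin σ (x + 1)) =
      perronRoot J * ∑ x, (coshWeight J (x - 1) + coshWeight J x) * u x * spin σ x := by
    rw [h2, h3, ← Finset.sum_add_distrib, Finset.mul_sum]
    refine Finset.sum_congr rfl fun x _ => ?_
    have h := eigen_equation (coshWeight_pos J) he x
    change _ = perronRoot J * _ at h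
    linear_combination spin σ x * h
  rw [h4]
  field_simp
  ring

/-! ### Contraction of a weighted Lipschitz seminorm -/

/-- If the increment of `g` under a flip at `x` is at most `L * a x`, then, for a suitable weight
`a`, one step of the dynamics shrinks this bound: the update at `y ≠ x` keeps the increment up to
an influence of `x` on `y`, and the update at `x` erases it. -/
lemma abs_mulVec_flip_sub_le (hn : 2 ≤ n) (hJ : ∀ i, 0 ≤ J i) {w : Fin n → ℝ} {l L : ℝ}
    (hw : ∀ i, 0 < w i) (hL : 0 ≤ L)
    (hlw : ∀ x, sinhWeight J (x - 1) * w (x - 1) + sinhWeight J x * w (x + 1) ≤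
      l * ((coshWeight J (x - 1) + coshWeight J x) * w x))
    {g : Config n → ℝ}
    (hg : ∀ σ x, |g (flip σ x) - g σ| ≤ L * ((coshWeight J (x - 1) + coshWeight J x) * w x))
    (σ : Config n) (x : Fin n) :
    |(transitionMatrix J).mulVec g (flip σ x) - (transitionMatrix J).mulVec g σ| ≤
      (1 - (1 - l) / n) * L * ((coshWeight J (x - 1) + coshWeight J x) * w x) := by
  have hn0 : (0 : ℝ) < n := Nat.cast_pos.mpr (NeZero.pos n)
  set a : Fin n → ℝ := fun x => (coshWeight J (x - 1) + coshWeight J x) * w x with ha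
  have ha0 : ∀ x, 0 ≤ a x := fun x => (mul_pos (coshWeight_add_pos J x) (hw x)).le
  set r : Config n → Fin n → ℝ := fun σ y => (1 - spin σ y * meanSpin J σ y) / 2 with hr
  have hP : ∀ τ, (transitionMatrix J).mulVec g τ =
      1 / (n : ℝ) * ∑ y, (g τ + r τ y * (g (flip τ y) - g τ)) := fun τ => by
    rw [transitionMatrix_mulVec, Finset.sum_add_distrib, Finset.sum_const, Finset.card_univ,
      Fintype.card_fin, nsmul_eq_mul, mul_add, Finset.mul_sum]
    congr 1
    · field_simp
    · exact Finset.sum_congr rfl fun y _ => by rw [flipProb_eq hn]; ring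
  have hr01 : ∀ τ y, 0 ≤ r τ y ∧ r τ y ≤ 1 := fun τ y => by
    have : |spin τ y * meanSpin J τ y| ≤ 1 := by
      rw [abs_mul, abs_spin, one_mul]; exact abs_meanSpin_le_one J τ y
    obtain ⟨h1, h2⟩ := abs_le.mp this
    constructor <;> simp only [hr] <;> linarith
  -- the influence of `x` on the update at `y`, multiplied by the weight of `y`
  set b : Fin n → ℝ := fun y => (if y - 1 = x then sinhWeight J (y - 1) * w y else 0) +
    (if y + 1 = x then sinhWeight J (y + 1 - 1) * w (y + 1 - 1) else 0) with hb
  have hterm : ∀ y, |(g (flip σ x) + r (flip σ x) y * (g (flip (flip σ x) y) - g (flip σ x))) -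
      (g σ + r σ y * (g (flip σ y) - g σ))| ≤ L * (a x - (if y = x then a y else 0) + b y) := by
    intro y
    by_cases hyx : y = x
    · subst hyx
      have h1 : r (flip σ y) y = 1 - r σ y := by
        simp only [hr]
        rw [spin_flip_self, meanSpin_flip_self hn]
        ring
      have hb0 : 0 ≤ b y := add_nonneg
        (by split_ifs <;> [exact mul_nonneg (sinhWeight_nonneg hJ _) (hw _).le; exact le_rfl])
        (by split_ifs <;> [exact mul_nonneg (sinhWeight_nonneg hJ _) (hw _).le; exact le_rfl])
      rw [h1, flip_flip, if_pos rfl, sub_self, zero_add,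
        show (g (flip σ y) + (1 - r σ y) * (g σ - g (flip σ y))) -
          (g σ + r σ y * (g (flip σ y) - g σ)) = 0 by ring, abs_zero]
      exact mul_nonneg hL hb0
    · rw [if_neg hyx, sub_zero]
      have hdr : |r (flip σ x) y - r σ y| * a y ≤ b y := by
        have h1 : r (flip σ x) y - r σ y =
            -(spin σ y * (meanSpin J (flip σ x) y - meanSpin J σ y)) / 2 := by
          simp only [hr]
          rw [spin_flip_of_ne σ hyx]
          ring
        have h2 := abs_meanSpin_flip_sub_le hJ σ x y
        rw [h1, abs_div, abs_neg, abs_mul, abs_spin, one_mul, abs_two]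
        have hd := coshWeight_add_pos J y
        calc _ ≤ (((if y - 1 = x then sinhWeight J (y - 1) else 0) +
              if y + 1 = x then sinhWeight J y else 0) /
                (coshWeight J (y - 1) + coshWeight J y)) * a y :=
              mul_le_mul_of_nonneg_right (by linarith) (ha0 y)
          _ = ((if y - 1 = x then sinhWeight J (y - 1) else 0) +
              if y + 1 = x then sinhWeight J y else 0) * w y := by
              simp only [ha]
              field_simp
          _ = b y := by
              simp only [hb, add_sub_cancel_right, add_mul, ite_mul, zero_mul]
      obtain ⟨hr0, hr1⟩ := hr01 σ y
      have e : (g (flip σ x) + r (flip σ x) y * (g (flip (flip σ x) y) - g (flip σ x))) -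
          (g σ + r σ y * (g (flip σ y) - g σ)) =
          (1 - r σ y) * (g (flip σ x) - g σ) + r σ y * (g (flip (flip σ y) x) - g (flip σ y)) +
            (r (flip σ x) y - r σ y) * (g (flip (flip σ x) y) - g (flip σ x)) := by
        rw [flip_comm σ y x]
        ring
      rw [e]
      calc _ ≤ |(1 - r σ y) * (g (flip σ x) - g σ)| +
            |r σ y * (g (flip (flip σ y) x) - g (flip σ y))| +
            |(r (flip σ x) y - r σ y) * (g (flip (flip σ x) y) - g (flip σ x))| := abs_add_three _ _ _
        _ ≤ (1 - r σ y) * (L * a x) + r σ y * (L * a x) + |r (flip σ x) y - r σ y| * (L * a y) := by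
            rw [abs_mul, abs_mul, abs_mul, abs_of_nonneg hr0, abs_of_nonneg (sub_nonneg.mpr hr1)]
            have hr1' := sub_nonneg.mpr hr1
            gcongr
            · exact hg σ x
            · exact hg (flip σ y) x
            · exact hg (flip σ x) y
        _ ≤ L * (a x + b y) := by nlinarith [mul_le_mul_of_nonneg_left hdr hL]
  have hbsum : ∑ y, b y = sinhWeight J (x - 1) * w (x - 1) + sinhWeight J x * w (x + 1) := by
    simp only [hb]
    rw [Finset.sum_add_distrib,
      sum_add_one fun y => if y = x then sinhWeight J (y - 1) * w (y - 1) else 0,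
      ← sum_add_one fun y => if y - 1 = x then sinhWeight J (y - 1) * w y else 0]
    simp only [add_sub_cancel_right, Finset.sum_ite_eq', Finset.mem_univ, if_true]
    ring
  rw [hP, hP, ← mul_sub, ← Finset.sum_sub_distrib, abs_mul, abs_of_pos (one_div_pos.mpr hn0)]
  calc _ ≤ 1 / (n : ℝ) * ∑ y, L * (a x - (if y = x then a y else 0) + b y) := by
        gcongr
        exact (Finset.abs_sum_le_sum_abs _ _).trans (Finset.sum_le_sum fun y _ => hterm y)
    _ = 1 / (n : ℝ) * (L * (n * a x - a x +
          (sinhWeight J (x - 1) * w (x - 1) + sinhWeight J x * w (x + 1)))) := by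
        rw [← Finset.mul_sum, Finset.sum_add_distrib, Finset.sum_sub_distrib, hbsum]
        simp only [Finset.sum_const, Finset.card_univ, Fintype.card_fin, nsmul_eq_mul,
          Finset.sum_ite_eq', Finset.mem_univ, if_true]
    _ ≤ 1 / (n : ℝ) * (L * (n * a x - a x + l * a x)) := by
        gcongr
        exact hlw x
    _ = _ := by field_simp; ring

/-- A nonconstant eigenfunction has eigenvalue at most that of the linear eigenfunction. The
weight of the seminorm is the Perron vector after adding `ε` to all weights of `crossForm`, which
makes it strictly positive even where couplings vanish. -/
lemma eigenvalue_le_of_nonconstant (hn : 2 ≤ n) (hJ : ∀ i, 0 ≤ J i) {e : ℝ} {g : Config n → ℝ}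
    (hge : (transitionMatrix J).mulVec g = e • g) (hg : ∃ σ τ, g σ ≠ g τ) :
    e ≤ 1 - (1 - perronRoot J) / n := by
  have hn0 : (0 : ℝ) < n := Nat.cast_pos.mpr (NeZero.pos n)
  refine le_of_forall_pos_le_add fun ε hε => ?_
  obtain ⟨w, hw, he⟩ := exists_pos_eigenvector (s := fun i => sinhWeight J i + n * ε)
    (c := coshWeight J) (fun i => add_pos_of_nonneg_of_pos (sinhWeight_nonneg hJ i) (by positivity))
    (coshWeight_pos J)
  have hle := topEigenvalue_add_le (s := sinhWeight J) (c := coshWeight J) (ε := n * ε)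
    (by positivity) (one_le_coshWeight J)
  change _ ≤ perronRoot J + n * ε at hle
  have heq := eigen_equation (coshWeight_pos J) he
  set a : Fin n → ℝ := fun x => (coshWeight J (x - 1) + coshWeight J x) * w x with ha
  have ha0 : ∀ x, 0 < a x := fun x => mul_pos (coshWeight_add_pos J x) (hw x)
  have hlw : ∀ x, sinhWeight J (x - 1) * w (x - 1) + sinhWeight J x * w (x + 1) ≤
      (perronRoot J + n * ε) * ((coshWeight J (x - 1) + coshWeight J x) * w x) := fun x => by
    have h1 := mul_le_mul_of_nonneg_right hle (ha0 x).le
    have h2 : 0 < n * ε * w (x - 1) := mul_pos (by positivity) (hw _)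
    have h3 : 0 < n * ε * w (x + 1) := mul_pos (by positivity) (hw _)
    have h4 := heq x
    simp only [ha] at h1
    linarith
  obtain ⟨p, hp⟩ := Finite.exists_max fun p : Config n × Fin n => |g (flip p.1 p.2) - g p.1| / a p.2
  set L := |g (flip p.1 p.2) - g p.1| / a p.2 with hLdef
  have hL0 : 0 ≤ L := div_nonneg (abs_nonneg _) (ha0 _).le
  have hgL : ∀ σ x, |g (flip σ x) - g σ| ≤ L * a x := fun σ x =>
    (div_le_iff₀ (ha0 x)).mp (hp (σ, x))
  have hLpos : 0 < L := by
    refine hL0.lt_of_ne fun h0 => ?_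
    obtain ⟨σ, τ, hστ⟩ := hg
    refine hστ (eq_of_flip_invariant (fun σ x => ?_) σ τ)
    have := hgL σ x
    rw [← h0, zero_mul] at this
    exact sub_eq_zero.mp (abs_nonpos_iff.mp this)
  have h := abs_mulVec_flip_sub_le hn hJ hw hL0 hlw hgL p.1 p.2
  rw [hge, Pi.smul_apply, Pi.smul_apply, smul_eq_mul, smul_eq_mul, ← mul_sub, abs_mul] at h
  have hpa : |g (flip p.1 p.2) - g p.1| = L * a p.2 := by
    rw [hLdef, div_mul_cancel₀ _ (ha0 _).ne']
  rw [hpa, ← mul_assoc] at h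
  have h1 := le_of_mul_le_mul_right (le_of_mul_le_mul_right h (ha0 p.2)) hLpos
  calc e ≤ |e| := le_abs_self e
    _ ≤ _ := h1
    _ = _ := by field_simp; ring

end Dynamics

/-! ### The second largest eigenvalue -/

section Spectrum

variable {n : ℕ} [NeZero n]

/-- Detailed balance with respect to the unnormalised Gibbs weight. -/
lemma weight_mul_transitionMatrix (J : Fin n → ℝ) (σ τ : Config n) :
    weight J σ * transitionMatrix J σ τ = weight J τ * transitionMatrix J τ σ := by
  rcases eq_or_ne τ σ with rfl | h
  · rfl
  · simp only [transitionMatrix, if_neg h, if_neg h.symm, zero_add, Finset.mul_sum]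
    refine Finset.sum_congr rfl fun x _ => ?_
    by_cases hx : τ = flip σ x
    · subst hx
      rw [flip_flip, if_pos rfl, if_pos rfl, flipProb_eq_weight, flipProb_eq_weight, flip_flip,
        add_comm (weight J (flip σ x))]
      ring
    · have hx' : σ ≠ flip τ x := fun h => hx (by rw [h, flip_flip])
      rw [if_neg hx, if_neg hx', mul_zero, mul_zero]

/-- The matrix of the dynamics in the basis that is orthonormal for the Gibbs weight; detailed
balance makes it symmetric. -/
noncomputable def symmetrizedMatrix (J : Fin n → ℝ) : Matrix (Config n) (Config n) ℝ :=
  Matrix.diagonal (fun σ => √(weight J σ)) * transitionMatrix J *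
    Matrix.diagonal (fun σ => (√(weight J σ))⁻¹)

lemma diagonal_inv_mul_diagonal (J : Fin n → ℝ) :
    Matrix.diagonal (fun σ => (√(weight J σ))⁻¹) * Matrix.diagonal (fun σ => √(weight J σ)) = 1 := by
  rw [Matrix.diagonal_mul_diagonal, ← Matrix.diagonal_one]
  congr 1
  funext σ
  exact inv_mul_cancel₀ (Real.sqrt_pos.mpr (weight_pos J σ)).ne'

lemma charpoly_symmetrizedMatrix (J : Fin n → ℝ) :
    (symmetrizedMatrix J).charpoly = (transitionMatrix J).charpoly := by
  rw [symmetrizedMatrix, Matrix.charpoly_mul_comm, ← Matrix.mul_assoc, diagonal_inv_mul_diagonal,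
    Matrix.one_mul]

lemma isHermitian_symmetrizedMatrix (J : Fin n → ℝ) : (symmetrizedMatrix J).IsHermitian := by
  refine Matrix.IsHermitian.ext fun σ τ => ?_
  rw [star_trivial, symmetrizedMatrix, Matrix.mul_diagonal, Matrix.mul_diagonal,
    Matrix.diagonal_mul, Matrix.diagonal_mul]
  have h1 := (Real.sqrt_pos.mpr (weight_pos J σ)).ne'
  have h2 := (Real.sqrt_pos.mpr (weight_pos J τ)).ne'
  have h := weight_mul_transitionMatrix J σ τ
  rw [← Real.mul_self_sqrt (weight_pos J σ).le, ← Real.mul_self_sqrt (weight_pos J τ).le] at h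
  field_simp
  linarith

/-- Dividing an eigenvector of the symmetrised matrix by the root of the weight gives an
eigenfunction of the dynamics. -/
lemma mulVec_of_symmetrizedMatrix {J : Fin n → ℝ} {e : ℝ} {v : Config n → ℝ}
    (hv : (symmetrizedMatrix J).mulVec v = e • v) :
    (transitionMatrix J).mulVec (fun σ => (√(weight J σ))⁻¹ * v σ) =
      e • fun σ => (√(weight J σ))⁻¹ * v σ := by
  have h1 : (fun σ => (√(weight J σ))⁻¹ * v σ) =
      (Matrix.diagonal (fun σ => (√(weight J σ))⁻¹)).mulVec v := by
    funext σ
    rw [Matrix.mulVec_diagonal]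
  rw [h1, ← Matrix.mulVec_smul, ← hv, symmetrizedMatrix, Matrix.mulVec_mulVec, Matrix.mulVec_mulVec,
    ← Matrix.mul_assoc, ← Matrix.mul_assoc, diagonal_inv_mul_diagonal, Matrix.one_mul]

lemma isRoot_charpoly_of_mulVec {ι : Type*} [Fintype ι] [DecidableEq ι] {A : Matrix ι ι ℝ} {e : ℝ}
    {g : ι → ℝ} (hg : g ≠ 0) (h : A.mulVec g = e • g) : A.charpoly.IsRoot e := by
  rw [← Matrix.mem_spectrum_iff_isRoot_charpoly, ← Matrix.spectrum_toLin']
  refine Module.End.HasEigenvalue.mem_spectrum ?_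
  exact Module.End.hasEigenvalue_of_hasEigenvector
    (Module.End.hasEigenvector_iff.mpr ⟨Module.End.mem_eigenspace_iff.mpr (by simpa using h), hg⟩)

lemma secondLargestEigenvalue_eq (hn : 2 ≤ n) {J : Fin n → ℝ} (hJ : ∀ i, 0 ≤ J i) :
    secondLargestEigenvalue (transitionMatrix J) = 1 - (1 - perronRoot J) / n := by
  have hn0 : (0 : ℝ) < n := Nat.cast_pos.mpr (NeZero.pos n)
  set m := 1 - (1 - perronRoot J) / n with hm
  have hm1 : m < 1 := by
    have := div_pos (sub_pos.mpr (perronRoot_lt_one J)) hn0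
    linarith
  have hB := isHermitian_symmetrizedMatrix J
  set ev := hB.eigenvalues₀ with hev
  have hanti : Antitone ev := hB.eigenvalues₀_antitone
  have hsort : (transitionMatrix J).charpoly.roots.sort (fun a b => b ≤ a) = List.ofFn ev := by
    rw [← charpoly_symmetrizedMatrix]
    have h := hB.sort_roots_charpoly_eq_eigenvalues₀
    rwa [show (RCLike.re : ℝ → ℝ) = id from rfl, Multiset.map_id] at h
  have hroot : ∀ e, (transitionMatrix J).charpoly.IsRoot e → ∃ k, ev k = e := fun e he => by
    have h1 : e ∈ (transitionMatrix J).charpoly.roots.sort (fun a b => b ≤ a) := by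
      rw [Multiset.mem_sort, Polynomial.mem_roots (Matrix.charpoly_monic _).ne_zero]
      exact he
    rw [hsort, List.mem_ofFn] at h1
    exact h1
  -- eigenvalues above `m` belong to the constant functions, so there is at most one
  have hconst : ∀ k, m < ev k → ∃ (i : Config n) (a : ℝ),
      i = (Fintype.equivOfCardEq (Fintype.card_fin _)) k ∧
      ∀ σ, hB.eigenvectorBasis i σ = a * √(weight J σ) := fun k hk => by
    refine ⟨_, (√(weight J 1))⁻¹ * hB.eigenvectorBasis
      ((Fintype.equivOfCardEq (Fintype.card_fin _)) k) 1, rfl, fun σ => ?_⟩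
    set i : Config n := (Fintype.equivOfCardEq (Fintype.card_fin _)) k with hi
    have he : hB.eigenvalues i = ev k := by simp [Matrix.IsHermitian.eigenvalues, hi, hev]
    have h1 := hB.mulVec_eigenvectorBasis i
    rw [he] at h1
    have h2 := mulVec_of_symmetrizedMatrix h1
    have h3 : ∀ σ τ, (√(weight J σ))⁻¹ * hB.eigenvectorBasis i σ =
        (√(weight J τ))⁻¹ * hB.eigenvectorBasis i τ := by
      by_contra! hcon
      exact absurd (eigenvalue_le_of_nonconstant hn hJ h2 hcon) (not_le.mpr hk)
    rw [h3 1 σ]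
    have := (Real.sqrt_pos.mpr (weight_pos J σ)).ne'
    field_simp
  have hunique : ∀ k k', m < ev k → m < ev k' → k = k' := fun k k' hk hk' => by
    obtain ⟨i, a, hi, ha⟩ := hconst k hk
    obtain ⟨i', a', hi', ha'⟩ := hconst k' hk'
    by_contra hne
    have hii : i ≠ i' := fun h => hne ((Equiv.injective _) (hi ▸ hi' ▸ h))
    have hnz : ∀ j, hB.eigenvectorBasis j ≠ 0 := fun j => by
      have := hB.eigenvectorBasis.orthonormal.1 j
      exact norm_ne_zero_iff.mp (by rw [this]; exact one_ne_zero)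
    have hcoef : ∀ j (b : ℝ), (∀ σ, hB.eigenvectorBasis j σ = b * √(weight J σ)) → b ≠ 0 := by
      rintro j b hb rfl
      exact hnz j (PiLp.ext fun σ => by simp [hb σ])
    have horth := hB.eigenvectorBasis.orthonormal.2 hii
    simp only [PiLp.inner_apply, ha, ha', RCLike.inner_apply, conj_trivial] at horth
    have hsum : ∑ σ, a' * √(weight J σ) * (a * √(weight J σ)) = a * a' * partitionFunction J := by
      rw [partitionFunction, Finset.mul_sum]
      refine Finset.sum_congr rfl fun σ _ => ?_
      linear_combination a * a' * Real.mul_self_sqrt (weight_pos J σ).le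
    rw [hsum] at horth
    exact mul_ne_zero (mul_ne_zero (hcoef i a ha) (hcoef i' a' ha'))
      (partitionFunction_pos J).ne' horth
  obtain ⟨k1, hk1⟩ := hroot 1 (isRoot_charpoly_of_mulVec (g := fun _ => 1)
    (Function.ne_iff.mpr ⟨1, one_ne_zero⟩) (by
      funext σ
      rw [transitionMatrix_mulVec]
      simp))
  obtain ⟨k2, hk2⟩ := hroot m (by
    obtain ⟨u, hu, hu0, he⟩ := exists_nonneg_eigenvector (sinhWeight_nonneg hJ) (coshWeight_pos J)
    refine isRoot_charpoly_of_mulVec (Function.ne_iff.mpr ⟨1, ?_⟩)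
      (transitionMatrix_mulVec_linear hn he)
    -- all spins are `+1` in the configuration `1`
    obtain ⟨x, hx⟩ := Function.ne_iff.mp hu
    refine (Finset.sum_pos' (fun i _ => ?_) ⟨x, Finset.mem_univ x, ?_⟩).ne'
    · have := mul_nonneg (coshWeight_add_pos J i).le (hu0 i)
      simpa [spin] using this
    · have := mul_pos (coshWeight_add_pos J x) ((hu0 x).lt_of_ne hx.symm)
      simpa [spin] using this)
  have hne : k1 ≠ k2 := fun h => by
    rw [h, hk2] at hk1
    exact hm1.ne hk1
  have hcard : 1 < Fintype.card (Config n) := by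
    have := k1.2
    have := k2.2
    have := Fin.val_ne_of_ne hne
    omega
  have h01 : ev ⟨1, hcard⟩ ≤ m := by
    by_contra! h
    have h0 : m < ev ⟨0, by omega⟩ := h.trans_le (hanti (by simp))
    have := hunique _ _ h h0
    simp at this
  have h0m : m ≤ ev ⟨1, hcard⟩ := by
    have hk20 : k2 ≠ ⟨0, by omega⟩ := fun h => by
      have : ev k1 ≤ ev k2 := hanti (by rw [h]; simp)
      linarith
    rw [← hk2]
    refine hanti (Fin.le_def.mpr ?_)
    have : k2.val ≠ 0 := fun h => hk20 (Fin.ext h)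
    show 1 ≤ k2.val
    omega
  rw [secondLargestEigenvalue, hsort, List.getD_eq_getElem _ _ (by simpa using hcard)]
  simpa using le_antisymm h01 h0m

lemma tauStar_eq (hn : 2 ≤ n) {J : Fin n → ℝ} (hJ : ∀ i, 0 ≤ J i) :
    tauStar J = perronRoot J / (1 - perronRoot J) := by
  have hn0 : (n : ℝ) ≠ 0 := Nat.cast_ne_zero.mpr (NeZero.ne n)
  have hl := (sub_pos.mpr (perronRoot_lt_one J)).ne'
  rw [tauStar, relaxationTime, secondLargestEigenvalue_eq hn hJ, sub_sub_cancel,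
    mul_div_cancel₀ _ hn0]
  field_simp
  ring

end Spectrum

end CycleIsing

theorem mainTheorem3 (n : ℕ) [NeZero n] (hn : 3 ≤ n) (J : Fin n → ℝ) (hJ : ∀ i, 0 ≤ J i)
    (t : ℝ) (ht : 0 ≤ t) :
    Real.exp (2 * t) * CycleIsing.tauStar J ≤ CycleIsing.tauStar (fun i => J i + t) := by
  have hn2 : 2 ≤ n := by omega
  rw [CycleIsing.tauStar_eq hn2 hJ,
    CycleIsing.tauStar_eq hn2 fun i => add_nonneg (hJ i) ht]
  exact CycleIsing.exp_mul_perron_le hJ ht
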